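/- Let $(\Omega,\mathcal F,P)$ be a probability space, $p\in[1,\infty)$, $1/p+1/q=1$, $\mathcal Z=L_p(\Omega,\mathcal F,P)$ and $\mathcal Z^*=L_q(\Omega,\mathcal F,P)$, paired by $\langle Z,\zeta\rangle=\int_\Omega Z\zeta\,dP$. Let $\mathfrak M$ be a nonempty set of probability measures $Q\ll P$ on $(\Omega,\mathcal F)$ with $dQ/dP\in L_q(\Omega,\mathcal F,P)$. For a $\sigma$-algebra $\mathcal G\subset\mathcal F$ and an extended real valued random variable $X$, let $\mathbb E_{Q|\mathcal G}[X]=\mathbb E_{Q|\mathcal G}[X^+]-\mathbb E_{Q|\mathcal G}[X^-]$, which is well-defined if the difference is $Q$-almost surely not of the form $\infty-\infty$; let $\operatorname{ess\,inf}\mathbb E_{Q|\mathcal G}[X]$ be the essential infimum, with respect to $P$, of the set of all ($\mathcal G$-measurable, extended real valued) versions of $\mathbb E_{Q|\mathcal G}[X]$; and, if $\mathbb E_{Q|\mathcal G}[X]$ is well-defined for all $Q\in\mathfrak M$, let the conditional distributionally robust functional $\mathcal R_{|\mathcal G}(X):\Omega\to[-\infty,\infty]$ be the $P$-almost surely smallest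 $\mathcal G$-measurable function with $\mathcal R_{|\mathcal G}(X)\ge\operatorname{ess\,inf}\mathbb E_{Q|\mathcal G}[X]$ $P$-almost surely for every $Q\in\mathfrak M$. Let $T\ge 1$ and let $\{\emptyset,\Omega\}=\mathcal F_1\subset\dots\subset\mathcal F_T=\mathcal F$ be a filtration. Suppose that for every $\sigma$-algebra $\mathcal G\subset\mathcal F$ conditional translation equivariance holds: $P$-almost surely $\mathcal R_{|\mathcal G}(Z+Y)=\mathcal R_{|\mathcal G}(Z)+Y$ and $\mathcal R_{|\mathcal G}(Y)=Y$, for all $Z\in\mathcal Z$ and all $\mathcal G$-measurable $Y\in\mathcal Z$. Suppose further that the composite functional $$\mathfrak R(Z)=\mathcal R_{|\mathcal F_1}\big(\mathcal R_{|\mathcal F_2}(\cdots\mathcal R_{|\mathcal F_T}(Z))\big)$$ is well-defined and finite valued for every $Z\in\mathcal Z$. Then there exists a convex, norm bounded, weak$^*$ (that is, $\sigma(L_q,L_p)$-) closed set $\widehat{\mathfrak A}\subset L_q(\Omega,\mathcal F,P)$ of probability densities ($\zeta\ge0$ $P$-almost surely and $\int_\Omega\zeta\,dP=1$ for all $\zeta\in\widehat{\mathfrak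 A}$) such that $$\mathfrak R(Z)=\sup_{\zeta\in\widehat{\mathfrak A}}\int_\Omega Z\zeta\,dP\qquad\text{for all }Z\in\mathcal Z,$$ and moreover $\mathfrak M\subset\widehat{\mathfrak M}$, where $\widehat{\mathfrak M}$ is the set of all probability measures $Q\ll P$ on $(\Omega,\mathcal F)$ with $dQ/dP\in\widehat{\mathfrak A}$. -/

import Mathlib

open MeasureTheory Set
open scoped ENNReal Topology

namespace DRO

variable {Ω : Type*}

/-- `Y : Ω → [-∞, ∞]` is a version of the conditional expectation `E_{Q|G}[X]` of an extended
real valued random variable `X`: it is `G`-measurable and `Q`-almost surely equal to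
`E_{Q|G}[X⁺] - E_{Q|G}[X⁻]`, where this difference has to be `Q`-almost surely well-defined
(never `∞ - ∞`). The conditional expectations `U`, `V` of the `[0, ∞]`-valued positive and
negative parts are characterized by their integrals over the sets of `G`. -/
def IsCondExpVersion (G : MeasurableSpace Ω) {m0 : MeasurableSpace Ω} (Q : Measure Ω)
    (X Y : Ω → EReal) : Prop :=
  Measurable[G] Y ∧
  ∃ U V : Ω → ℝ≥0∞, Measurable[G] U ∧ Measurable[G] V ∧
    (∀ A : Set Ω, MeasurableSet[G] A →
      ∫⁻ ω in A, U ω ∂Q = ∫⁻ ω in A, (X ω).toENNReal ∂Q) ∧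
    (∀ A : Set Ω, MeasurableSet[G] A →
      ∫⁻ ω in A, V ω ∂Q = ∫⁻ ω in A, (-(X ω)).toENNReal ∂Q) ∧
    (∀ᵐ ω ∂Q, U ω ≠ ⊤ ∨ V ω ≠ ⊤) ∧
    (∀ᵐ ω ∂Q, Y ω = (U ω : EReal) - (V ω : EReal))

/-- `L` is (a version of) the essential infimum, with respect to the reference measure `P`, of the
set `S` of extended real valued functions. -/
def IsEssInf {m0 : MeasurableSpace Ω} (P : Measure Ω) (S : Set (Ω → EReal)) (L : Ω → EReal) :
    Prop :=
  Measurable L ∧ (∀ X ∈ S, L ≤ᵐ[P] X) ∧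
    ∀ Y : Ω → EReal, Measurable Y → (∀ X ∈ S, Y ≤ᵐ[P] X) → Y ≤ᵐ[P] L

/-- `R` is a version of the conditional distributionally robust functional
`R_{|G}(X) = ess sup_{Q ∈ M} E_{Q|G}[X]`. All conditional expectations `E_{Q|G}[X]`, `Q ∈ M`, have
to be well-defined; `L Q` is `ess inf E_{Q|G}[X]`, the essential infimum with respect to `P` of the
set of all versions of `E_{Q|G}[X]`; and `R` is the least `G`-measurable function that dominates,
`P`-almost surely, every `L Q` with `Q ∈ M`. -/
def IsCondRobust (G : MeasurableSpace Ω) {m0 : MeasurableSpace Ω} (P : Measure Ω)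
    (M : Set (Measure Ω)) (X R : Ω → EReal) : Prop :=
  ∃ L : Measure Ω → Ω → EReal,
    (∀ Q ∈ M, {Y | IsCondExpVersion G Q X Y}.Nonempty ∧
      IsEssInf P {Y | IsCondExpVersion G Q X Y} (L Q)) ∧
    Measurable[G] R ∧
    (∀ Q ∈ M, L Q ≤ᵐ[P] R) ∧
    ∀ Y : Ω → EReal, Measurable[G] Y → (∀ Q ∈ M, L Q ≤ᵐ[P] Y) → R ≤ᵐ[P] Y

/-- Translation equivariance of the conditional functional `R_{|G}` on `L_p`, in the `P`-almost
sure sense: `R_{|G}(Z + Y) = R_{|G}(Z) + Y` and `R_{|G}(Y) = Y` for all `Z ∈ L_p` and all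
`G`-measurable `Y ∈ L_p`. -/
def CondTranslationEquivariant (G : MeasurableSpace Ω) {m0 : MeasurableSpace Ω} (p : ℝ≥0∞)
    (P : Measure Ω) (M : Set (Measure Ω)) : Prop :=
  (∀ Z Y : Ω → ℝ, Measurable Z → MemLp Z p P → Measurable[G] Y → MemLp Y p P →
    ∀ R R' : Ω → EReal, IsCondRobust G P M (fun ω => (Z ω : EReal)) R →
      IsCondRobust G P M (fun ω => ((Z ω + Y ω : ℝ) : EReal)) R' →
      ∀ᵐ ω ∂P, R' ω = R ω + (Y ω : EReal)) ∧
  (∀ Y : Ω → ℝ, Measurable[G] Y → MemLp Y p P →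
    ∀ R : Ω → EReal, IsCondRobust G P M (fun ω => (Y ω : EReal)) R →
      ∀ᵐ ω ∂P, R ω = (Y ω : EReal))

/-- `r` is the value `R_{|F_1}(R_{|F_2}(⋯ R_{|F_T}(X)))` of the composite functional at `X`
(for `T ≥ 1` and trivial `F_1`, so that the outermost functional is a constant): here
`W (T + 1) = X` and `W t = R_{|F_t}(W (t + 1))` for `t = T, …, 1`. -/
def IsCompositeValue {m0 : MeasurableSpace Ω} (P : Measure Ω) (M : Set (Measure Ω))
    (F : ℕ → MeasurableSpace Ω) (T : ℕ) (X : Ω → EReal) (r : EReal) : Prop :=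
  ∃ W : ℕ → Ω → EReal, W (T + 1) = X ∧
    (∀ t ∈ Finset.Icc 1 T, IsCondRobust (F t) P M (W (t + 1)) (W t)) ∧
    ∀ ω, W 1 ω = r

/-- The weak* topology on `L_q = (L_p)*`: the coarsest topology for which all the functionals
`ζ ↦ ∫ Z ζ dP`, `Z ∈ L_p`, are continuous. -/
@[reducible] noncomputable def weakStarTopology {m0 : MeasurableSpace Ω} (p q : ℝ≥0∞) (P : Measure Ω) :
    TopologicalSpace (Lp ℝ q P) :=
  TopologicalSpace.induced (fun (ζ : Lp ℝ q P) (Z : Lp ℝ p P) => ∫ ω, Z ω * ζ ω ∂P)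
    Pi.topologicalSpace

/-- `ζ` is a probability density with respect to `P`. -/
def IsDensity {m0 : MeasurableSpace Ω} {q : ℝ≥0∞} (P : Measure Ω) (ζ : Lp ℝ q P) : Prop :=
  0 ≤ᵐ[P] (ζ : Ω → ℝ) ∧ ∫ ω, ζ ω ∂P = 1

/-- The set of probability measures `Q`, absolutely continuous with respect to `P`, whose density
`dQ/dP` belongs to `A`. -/
def measuresOf {m0 : MeasurableSpace Ω} {q : ℝ≥0∞} (P : Measure Ω) (A : Set (Lp ℝ q P)) :
    Set (Measure Ω) :=
  {Q | IsProbabilityMeasure Q ∧ Q ≪ P ∧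
    ∃ ζ ∈ A, (ζ : Ω → ℝ) =ᵐ[P] fun ω => (Q.rnDeriv P ω).toReal}

end DRO

/-!
The composite functional is a finite, monotone, sublinear functional `N` on `L_p` with
`N c = c` for constants, and the set `A` is the set of all `ζ ∈ L_q` with `∫ Z ζ dP ≤ N Z` for all
`Z`; the rest is duality.

*Probabilistic part.* By translation equivariance a set that is null for every `Q ∈ M` is `P`-null
(`measure_eq_zero_of_forall`). Since `R_{|G}(X) ≥ E_{Q|G}[X]` holds `Q`-almost surely, finiteness of
the composite functional forces every intermediate value `W t` to be `Q`-integrable for all `Q ∈ M`,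
hence finite `P`-almost surely (`exists_isRobustProcess`). The extended real valued iteration thus
reduces to one with real random variables and ordinary conditional expectations, where `w t` is the
least `F_t`-measurable variable that dominates `E_{Q|F_t}[w (t + 1)]` `Q`-almost surely for each
`Q ∈ M`. Minimality propagates inequalities `X ≤ a Y + b Z + c`, `a, b ≥ 0`, through the iteration
(`IsRobustProcess.le_comb`); this single property contains monotonicity, sublinearity and the
behaviour on constants. The tower property gives `∫ Z dQ ≤ N Z` (`IsRobustProcess.integral_le`),
which places `dQ/dP` in `A`.

*Functional analytic part.* A monotone positively homogeneous functional on a Banach lattice is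
bounded on the unit ball (`exists_le_mul_norm_of_monotone`). With the converse Hölder inequality
(`eLpNorm_le_of_forall_lintegral_mul_le`) this bounds `A`. By Hahn–Banach each value `N Z` is
attained by a positive continuous linear functional below `N`, and such functionals are represented by
elements of `L_q` (`exists_forall_eq_integral_of_nonneg`, through the Radon–Nikodym derivative of
`s ↦ f(1_s)`).
-/

namespace DRO

variable {Ω : Type*}

/-! ### Conditional expectations and the conditional robust functional -/

lemma IsCondExpVersion.ae_eq {G m0 : MeasurableSpace Ω} (hG : G ≤ m0) {Q : Measure Ω}
    [IsFiniteMeasure Q] {X Y Y' : Ω → EReal} (h : IsCondExpVersion G Q X Y)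
    (h' : IsCondExpVersion G Q X Y') : Y =ᵐ[Q] Y' := by
  obtain ⟨-, U, V, hU, hV, hUi, hVi, -, hY⟩ := h
  obtain ⟨-, U', V', hU', hV', hUi', hVi', -, hY'⟩ := h'
  have key : ∀ {f g : Ω → ℝ≥0∞}, Measurable[G] f → Measurable[G] g →
      (∀ A, MeasurableSet[G] A → ∫⁻ ω in A, f ω ∂Q = ∫⁻ ω in A, g ω ∂Q) → f =ᵐ[Q] g := by
    intro f g hf hg hfg
    refine ae_eq_of_ae_eq_trim (hm := hG) ?_
    refine ae_eq_of_forall_setLIntegral_eq_of_sigmaFinite hf hg fun A hA _ => ?_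
    rw [restrict_trim hG _ hA, lintegral_trim hG hf, lintegral_trim hG hg, hfg A hA]
  filter_upwards [hY, hY', key hU hU' fun A hA => (hUi A hA).trans (hUi' A hA).symm,
    key hV hV' fun A hA => (hVi A hA).trans (hVi' A hA).symm] with ω h1 h2 h3 h4
  rw [h1, h2, h3, h4]

/-- Versions of a conditional expectation under `Q` may be modified on `Q`-null sets. -/
lemma IsCondExpVersion.congr {G m0 : MeasurableSpace Ω} {Q : Measure Ω} {X Y Y' : Ω → EReal}
    (h : IsCondExpVersion G Q X Y) (hY' : Measurable[G] Y') (hYY' : Y' =ᵐ[Q] Y) :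
    IsCondExpVersion G Q X Y' := by
  obtain ⟨-, U, V, hU, hV, hUi, hVi, hUV, hY⟩ := h
  exact ⟨hY', U, V, hU, hV, hUi, hVi, hUV, hYY'.trans hY⟩

/-- The essential infimum, with respect to `P`, of the versions of `E_{Q|G}[X]` is `Q`-almost surely
at least any of them: all versions agree `P`-almost surely where `dQ/dP` does not vanish, so that
`Y` there, and `-∞` on the `Q`-null rest, is an essential lower bound. -/
lemma IsCondExpVersion.le_essInf {G m0 : MeasurableSpace Ω} (hG : G ≤ m0) {P Q : Measure Ω}
    [IsFiniteMeasure P] [IsFiniteMeasure Q] (hQP : Q ≪ P) {X Y L : Ω → EReal}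
    (h : IsCondExpVersion G Q X Y) (hL : IsEssInf P {Y | IsCondExpVersion G Q X Y} L) :
    Y ≤ᵐ[Q] L := by
  classical
  set S : Set Ω := {ω | Q.rnDeriv P ω ≠ 0}
  have hS : MeasurableSet S :=
    (Measure.measurable_rnDeriv Q P) (measurableSet_singleton 0).compl
  have hQS : ∀ᵐ ω ∂Q, ω ∈ S := by
    filter_upwards [Measure.rnDeriv_pos hQP] with ω hω using hω.ne'
  -- the restriction of `P` to `S` is absolutely continuous with respect to `Q`
  have hPS : ∀ p : Ω → Prop, (∀ᵐ ω ∂Q, p ω) → ∀ᵐ ω ∂P, ω ∈ S → p ω := by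
    intro p hp
    rw [← Measure.withDensity_rnDeriv_eq Q P hQP] at hp
    exact (ae_withDensity_iff (Measure.measurable_rnDeriv Q P)).1 hp
  have hle := hL.2.2 (S.piecewise Y fun _ => ⊥)
    (Measurable.piecewise hS (h.1.mono hG le_rfl) measurable_const) (by
      intro Y' hY'
      filter_upwards [hPS _ (h.ae_eq hG hY')] with ω hω
      by_cases hωS : ω ∈ S
      · simp [hωS, hω hωS]
      · simp [hωS])
  filter_upwards [hQS, hQP.ae_le hle] with ω hω h1
  simpa [hω] using h1

lemma IsCondRobust.version_le {G m0 : MeasurableSpace Ω} (hG : G ≤ m0) {P Q : Measure Ω}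
    [IsFiniteMeasure P] [IsFiniteMeasure Q] (hQP : Q ≪ P) {M : Set (Measure Ω)} (hQ : Q ∈ M)
    {X R Y : Ω → EReal} (hR : IsCondRobust G P M X R) (hY : IsCondExpVersion G Q X Y) :
    Y ≤ᵐ[Q] R := by
  obtain ⟨L, hL, -, hLR, -⟩ := hR
  exact (hY.le_essInf hG hQP (hL Q hQ).2).trans (hQP.ae_le (hLR Q hQ))

lemma IsCondRobust.exists_version {G m0 : MeasurableSpace Ω} {P Q : Measure Ω}
    {M : Set (Measure Ω)} (hQ : Q ∈ M) {X R : Ω → EReal} (hR : IsCondRobust G P M X R) :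
    ∃ Y, IsCondExpVersion G Q X Y := by
  obtain ⟨L, hL, -⟩ := hR
  exact (hL Q hQ).1

/-- To bound `R_{|G}(X)` from above `P`-almost surely it is enough to bound each `E_{Q|G}[X]`
`Q`-almost surely: if `Y₀` is a version below `Y`, then `min Y₀ Y` is a version too. -/
lemma IsCondRobust.le_of_version_le {G m0 : MeasurableSpace Ω} {P : Measure Ω}
    {M : Set (Measure Ω)} {X R Y : Ω → EReal} (hR : IsCondRobust G P M X R) (hY : Measurable[G] Y)
    (h : ∀ Q ∈ M, ∃ Y₀, IsCondExpVersion G Q X Y₀ ∧ Y₀ ≤ᵐ[Q] Y) : R ≤ᵐ[P] Y := by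
  obtain ⟨L, hL, -, -, hmin⟩ := hR
  refine hmin Y hY fun Q hQ => ?_
  obtain ⟨Y₀, hY₀, hle⟩ := h Q hQ
  have hm : IsCondExpVersion G Q X (fun ω => min (Y₀ ω) (Y ω)) := by
    refine hY₀.congr (Measurable.min hY₀.1 hY) ?_
    filter_upwards [hle] with ω hω using min_eq_left hω
  filter_upwards [(hL Q hQ).2.2.1 _ hm] with ω hω using hω.trans (min_le_right _ _)

/-- For a `G`-measurable real random variable, the variable itself is a version. -/
lemma isCondExpVersion_self {G m0 : MeasurableSpace Ω} {Q : Measure Ω} {X : Ω → ℝ}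
    (hX : Measurable[G] X) :
    IsCondExpVersion G Q (fun ω => (X ω : EReal)) (fun ω => (X ω : EReal)) := by
  have hX' : Measurable[G] fun ω => (X ω : EReal) := measurable_coe_real_ereal.comp hX
  refine ⟨hX', fun ω => (X ω : EReal).toENNReal, fun ω => (-(X ω : EReal)).toENNReal, ?_, ?_,
    fun _ _ => rfl, fun _ _ => rfl, ?_, ?_⟩
  · exact hX'.ereal_toENNReal
  · exact (hX'.neg).ereal_toENNReal
  · refine .of_forall fun ω => Or.inl ?_
    simp
  · refine .of_forall fun ω => ?_
    beta_reduce
    rw [← EReal.coe_neg, EReal.toENNReal_of_ne_top (EReal.coe_ne_top _),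
      EReal.toENNReal_of_ne_top (EReal.coe_ne_top _), EReal.toReal_coe, EReal.toReal_coe,
      EReal.coe_ennreal_ofReal, EReal.coe_ennreal_ofReal]
    norm_cast
    rcases le_total 0 (X ω) with h | h <;> simp [h]

/-- Under translation equivariance the measures in `M` jointly charge every set that `P` charges:
on a measurable set `A` that is null for all of them, minimality lowers `R_{|F}(X)` to `-∞`
there, whereas equivariance gives `R_{|F}(X) = X`. -/
lemma measure_eq_zero_of_forall {m0 : MeasurableSpace Ω} {P : Measure Ω} {p : ℝ≥0∞}
    {M : Set (Measure Ω)} (hTE : CondTranslationEquivariant m0 p P M) {X : Ω → ℝ}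
    (hX : Measurable X) (hXp : MemLp X p P) {R : Ω → EReal}
    (hR : IsCondRobust m0 P M (fun ω => (X ω : EReal)) R) {A : Set Ω} (hA : MeasurableSet A)
    (h : ∀ Q ∈ M, Q A = 0) : P A = 0 := by
  classical
  have h1 := hTE.2 X hX hXp R hR
  have h2 : R ≤ᵐ[P] A.piecewise (fun _ => ⊥) fun ω => (X ω : EReal) := by
    refine hR.le_of_version_le
      (Measurable.piecewise hA measurable_const (measurable_coe_real_ereal.comp hX)) ?_
    intro Q hQ
    refine ⟨_, isCondExpVersion_self hX, ?_⟩
    filter_upwards [measure_eq_zero_iff_ae_notMem.1 (h Q hQ)] with ω hω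
    simp [hω]
  refine measure_eq_zero_iff_ae_notMem.2 ?_
  filter_upwards [h1, h2] with ω h1 h2 hω
  rw [h1] at h2
  simp [hω] at h2

/-! ### Reduction of the iteration to real random variables -/

lemma toENNReal_neg_le_of_sub_le {U V : ℝ≥0∞} {r : EReal} (hV : V ≠ ⊤)
    (h : (U : EReal) - (V : EReal) ≤ r) : (-r).toENNReal ≤ V := by
  have h1 : -r ≤ (V : EReal) := by
    refine EReal.neg_le_of_neg_le (le_trans ?_ h)
    lift V to NNReal using hV
    rw [sub_eq_add_neg]
    exact le_add_of_nonneg_left (EReal.coe_ennreal_nonneg U)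
  simpa using EReal.toENNReal_le_toENNReal h1

lemma le_toENNReal_add_of_sub_le {U V : ℝ≥0∞} {r : EReal} (hV : V ≠ ⊤)
    (h : (U : EReal) - (V : EReal) ≤ r) : U ≤ r.toENNReal + V := by
  have hVt : (V : EReal) ≠ ⊤ := by simpa using hV
  have h1 : (U : EReal) ≤ r + V :=
    EReal.sub_le_iff_le_add (.inl (EReal.coe_ennreal_ne_bot V)) (.inl hVt) |>.1 h
  have h2 := EReal.toENNReal_le_toENNReal h1
  rw [EReal.toENNReal_coe] at h2
  exact h2.trans (EReal.toENNReal_add_le.trans (by simp))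

lemma IsCondRobust.lintegral_neg_lt_top {G m0 : MeasurableSpace Ω} (hG : G ≤ m0)
    {P Q : Measure Ω} [IsFiniteMeasure P] [IsFiniteMeasure Q] (hQP : Q ≪ P) {M : Set (Measure Ω)}
    (hQ : Q ∈ M) {X R : Ω → EReal} (hR : IsCondRobust G P M X R)
    (hX : ∫⁻ ω, (-(X ω)).toENNReal ∂Q < ⊤) : ∫⁻ ω, (-(R ω)).toENNReal ∂Q < ⊤ := by
  obtain ⟨Y, hY⟩ := hR.exists_version hQ
  have hYR := hR.version_le hG hQP hQ hY
  obtain ⟨-, U, V, hU, hV, hUi, hVi, -, hUV⟩ := hY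
  have hVint : ∫⁻ ω, V ω ∂Q = ∫⁻ ω, (-(X ω)).toENNReal ∂Q := by
    simpa using hVi univ MeasurableSet.univ
  rw [← hVint] at hX
  refine lt_of_le_of_lt (lintegral_mono_ae ?_) hX
  filter_upwards [ae_lt_top (hV.mono hG le_rfl) hX.ne, hUV, hYR] with ω h1 h2 h3
  exact toENNReal_neg_le_of_sub_le h1.ne (h2 ▸ h3)

lemma IsCondRobust.lintegral_pos_lt_top {G m0 : MeasurableSpace Ω} (hG : G ≤ m0)
    {P Q : Measure Ω} [IsFiniteMeasure P] [IsFiniteMeasure Q] (hQP : Q ≪ P) {M : Set (Measure Ω)}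
    (hQ : Q ∈ M) {X R : Ω → EReal} (hR : IsCondRobust G P M X R)
    (hX : ∫⁻ ω, (-(X ω)).toENNReal ∂Q < ⊤) (hRi : ∫⁻ ω, (R ω).toENNReal ∂Q < ⊤) :
    ∫⁻ ω, (X ω).toENNReal ∂Q < ⊤ := by
  obtain ⟨Y, hY⟩ := hR.exists_version hQ
  have hYR := hR.version_le hG hQP hQ hY
  obtain ⟨-, U, V, hU, hV, hUi, hVi, -, hUV⟩ := hY
  have hVint : ∫⁻ ω, V ω ∂Q = ∫⁻ ω, (-(X ω)).toENNReal ∂Q := by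
    simpa using hVi univ MeasurableSet.univ
  have hUint : ∫⁻ ω, U ω ∂Q = ∫⁻ ω, (X ω).toENNReal ∂Q := by
    simpa using hUi univ MeasurableSet.univ
  rw [← hVint] at hX
  rw [← hUint]
  have hle : ∫⁻ ω, U ω ∂Q ≤ ∫⁻ ω, ((R ω).toENNReal + V ω) ∂Q := by
    refine lintegral_mono_ae ?_
    filter_upwards [ae_lt_top (hV.mono hG le_rfl) hX.ne, hUV, hYR] with ω h1 h2 h3
    exact le_toENNReal_add_of_sub_le h1.ne (h2 ▸ h3)
  rw [lintegral_add_right _ (hV.mono hG le_rfl)] at hle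
  exact hle.trans_lt (ENNReal.add_lt_top.2 ⟨hRi, hX⟩)

lemma toReal_eq_sub_toENNReal {x : EReal} (h1 : x ≠ ⊤) (h2 : x ≠ ⊥) :
    x.toReal = x.toENNReal.toReal - (-x).toENNReal.toReal := by
  lift x to ℝ using ⟨h1, h2⟩
  rw [← EReal.coe_neg, EReal.toENNReal_of_ne_top (EReal.coe_ne_top _),
      EReal.toENNReal_of_ne_top (EReal.coe_ne_top _), EReal.toReal_coe, EReal.toReal_coe]
  rcases le_total 0 x with h | h <;> simp [h, ENNReal.toReal_ofReal, ENNReal.ofReal_of_nonpos]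

lemma ae_finite_of_lintegral_lt_top {m0 : MeasurableSpace Ω} {Q : Measure Ω} {X : Ω → EReal}
    (hX : Measurable X) (h1 : ∫⁻ ω, (X ω).toENNReal ∂Q < ⊤)
    (h2 : ∫⁻ ω, (-(X ω)).toENNReal ∂Q < ⊤) : ∀ᵐ ω ∂Q, X ω ≠ ⊤ ∧ X ω ≠ ⊥ := by
  filter_upwards [ae_lt_top hX.ereal_toENNReal h1.ne, ae_lt_top hX.neg.ereal_toENNReal h2.ne]
    with ω h3 h4
  refine ⟨fun h => by simp [h] at h3, fun h => by simp [h] at h4⟩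

lemma integrable_toReal_of_lintegral_lt_top {m0 : MeasurableSpace Ω} {Q : Measure Ω}
    {X : Ω → EReal} (hX : Measurable X) (h1 : ∫⁻ ω, (X ω).toENNReal ∂Q < ⊤)
    (h2 : ∫⁻ ω, (-(X ω)).toENNReal ∂Q < ⊤) : Integrable (fun ω => (X ω).toReal) Q := by
  have := (integrable_toReal_of_lintegral_ne_top hX.ereal_toENNReal.aemeasurable h1.ne).sub
    (integrable_toReal_of_lintegral_ne_top hX.neg.ereal_toENNReal.aemeasurable h2.ne)
  refine this.congr ?_
  filter_upwards [ae_finite_of_lintegral_lt_top hX h1 h2] with ω h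
  exact (toReal_eq_sub_toENNReal h.1 h.2).symm

/-- For integrable random variables the extended real valued notion of conditional expectation
reduces to the usual one. -/
lemma IsCondExpVersion.ae_eq_condExp {G m0 : MeasurableSpace Ω} (hG : G ≤ m0) {Q : Measure Ω}
    [IsFiniteMeasure Q] {X Y : Ω → EReal} (hX : Measurable X) (h : IsCondExpVersion G Q X Y)
    (h1 : ∫⁻ ω, (X ω).toENNReal ∂Q < ⊤) (h2 : ∫⁻ ω, (-(X ω)).toENNReal ∂Q < ⊤) :
    ∀ᵐ ω ∂Q, Y ω = ((Q[fun ω => (X ω).toReal | G] ω : ℝ) : EReal) := by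
  obtain ⟨-, U, V, hU, hV, hUi, hVi, -, hUV⟩ := h
  have hVint : ∫⁻ ω, V ω ∂Q = ∫⁻ ω, (-(X ω)).toENNReal ∂Q := by
    simpa using hVi univ MeasurableSet.univ
  have hUint : ∫⁻ ω, U ω ∂Q = ∫⁻ ω, (X ω).toENNReal ∂Q := by
    simpa using hUi univ MeasurableSet.univ
  have hU' := hU.mono hG le_rfl
  have hV' := hV.mono hG le_rfl
  have iU := integrable_toReal_of_lintegral_ne_top hU'.aemeasurable (hUint ▸ h1.ne)
  have iV := integrable_toReal_of_lintegral_ne_top hV'.aemeasurable (hVint ▸ h2.ne)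
  have iX1 := integrable_toReal_of_lintegral_ne_top hX.ereal_toENNReal.aemeasurable h1.ne
  have iX2 : Integrable (fun ω => (-(X ω)).toENNReal.toReal) Q :=
    integrable_toReal_of_lintegral_ne_top hX.neg.ereal_toENNReal.aemeasurable h2.ne
  have fX1 := ae_lt_top hX.ereal_toENNReal h1.ne
  have fX2 : ∀ᵐ ω ∂Q, (-(X ω)).toENNReal < ⊤ := ae_lt_top hX.neg.ereal_toENNReal h2.ne
  have fU := ae_lt_top hU' (hUint ▸ h1.ne)
  have fV := ae_lt_top hV' (hVint ▸ h2.ne)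
  have hce : (fun ω => (U ω).toReal - (V ω).toReal) =ᵐ[Q] Q[fun ω => (X ω).toReal | G] := by
    refine ae_eq_condExp_of_forall_setIntegral_eq hG
      (integrable_toReal_of_lintegral_lt_top hX h1 h2) (fun s _ _ => (iU.sub iV).integrableOn)
      (fun s hs _ => ?_) ?_
    · have : ∫ ω in s, (X ω).toReal ∂Q
          = ∫ ω in s, ((X ω).toENNReal.toReal - (-(X ω)).toENNReal.toReal) ∂Q := by
        refine integral_congr_ae (ae_restrict_of_ae ?_)
        filter_upwards [ae_finite_of_lintegral_lt_top hX h1 h2] with ω h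
        exact toReal_eq_sub_toENNReal h.1 h.2
      rw [this, integral_sub iU.integrableOn iV.integrableOn,
        integral_sub iX1.integrableOn iX2.integrableOn,
        integral_toReal hU'.aemeasurable (ae_restrict_of_ae fU),
        integral_toReal hV'.aemeasurable (ae_restrict_of_ae fV),
        integral_toReal hX.ereal_toENNReal.aemeasurable (ae_restrict_of_ae fX1),
        integral_toReal (f := fun ω => (-(X ω)).toENNReal) hX.neg.ereal_toENNReal.aemeasurable
          (ae_restrict_of_ae fX2),
        hUi s hs, hVi s hs]
    · exact (hU.ennreal_toReal.sub hV.ennreal_toReal).stronglyMeasurable.aestronglyMeasurable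
  filter_upwards [hUV, hce, fU, fV] with ω e1 e2 e3 e4
  rw [e1, ← e2, EReal.coe_sub, EReal.coe_ennreal_toReal e3.ne, EReal.coe_ennreal_toReal e4.ne]

/-- A real valued form of the iteration `w t = R_{|F_t}(w (t + 1))`, `t = T, …, 1`: every `w t` is
integrable under all the measures in `M`, and `w t` is the least `F_t`-measurable random variable
that dominates `E_{Q|F_t}[w (t + 1)]` `Q`-almost surely for each `Q ∈ M`. -/
structure IsRobustProcess {m0 : MeasurableSpace Ω} (P : Measure Ω) (M : Set (Measure Ω))
    (F : ℕ → MeasurableSpace Ω) (T : ℕ) (w : ℕ → Ω → ℝ) : Prop where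
  integrable : ∀ t ∈ Finset.Icc 1 (T + 1), ∀ Q ∈ M, Integrable (w t) Q
  measurable : ∀ t ∈ Finset.Icc 1 T, Measurable[F t] (w t)
  condExp_le : ∀ t ∈ Finset.Icc 1 T, ∀ Q ∈ M, Q[w (t + 1) | F t] ≤ᵐ[Q] w t
  le_of_condExp_le : ∀ t ∈ Finset.Icc 1 T, ∀ y : Ω → ℝ, Measurable[F t] y →
    (∀ Q ∈ M, Q[w (t + 1) | F t] ≤ᵐ[Q] y) → w t ≤ᵐ[P] y

/-- A finite composite value is attained by a real valued iteration. Going down from `T`, the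
negative parts stay integrable because `R_{|F_t}(X) ≥ E_{Q|F_t}[X]`; going up from the finite
constant `r`, the same inequality makes the positive parts integrable. Infinite values then have
probability zero under every `Q ∈ M`, and hence under `P`. -/
lemma exists_isRobustProcess {m0 : MeasurableSpace Ω} {P : Measure Ω} [IsFiniteMeasure P]
    {M : Set (Measure Ω)} (hM : ∀ Q ∈ M, IsProbabilityMeasure Q ∧ Q ≪ P)
    (hnull : ∀ A, MeasurableSet A → (∀ Q ∈ M, Q A = 0) → P A = 0)
    {F : Filtration ℕ m0} {T : ℕ} {Z : Ω → ℝ} (hZ : Measurable Z)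
    (hZi : ∀ Q ∈ M, Integrable Z Q) {r : ℝ}
    (h : IsCompositeValue P M F T (fun ω => (Z ω : EReal)) (r : EReal)) :
    ∃ w : ℕ → Ω → ℝ, IsRobustProcess P M F T w ∧ w (T + 1) = Z ∧ w 1 = fun _ => r := by
  obtain ⟨W, hWT, hW, hW1⟩ := h
  have hmeas : ∀ t ∈ Finset.Icc 1 (T + 1), Measurable (W t) := by
    intro t ht
    rw [Finset.mem_Icc] at ht
    rcases ht.2.lt_or_eq with h | rfl
    · obtain ⟨L, -, hm, -⟩ := hW t (Finset.mem_Icc.2 ⟨ht.1, by omega⟩)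
      exact hm.mono (F.le t) le_rfl
    · rw [hWT]; exact measurable_coe_real_ereal.comp hZ
  have hneg : ∀ Q ∈ M, ∀ t ∈ Finset.Icc 1 (T + 1), ∫⁻ ω, (-(W t ω)).toENNReal ∂Q < ⊤ := by
    intro Q hQ t ht
    have := (hM Q hQ).1
    rw [Finset.mem_Icc] at ht
    refine Nat.decreasingInduction' (P := fun t => ∫⁻ ω, (-(W t ω)).toENNReal ∂Q < ⊤)
      (fun k hk1 hk2 ih => ?_) ht.2 ?_
    · exact (hW k (Finset.mem_Icc.2 ⟨by omega, by omega⟩)).lintegral_neg_lt_top (F.le k)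
        (hM Q hQ).2 hQ ih
    · rw [hWT]
      refine lt_of_le_of_lt (lintegral_mono fun ω => ?_) (hZi Q hQ).2
      rw [← EReal.coe_neg, EReal.toENNReal_of_ne_top (EReal.coe_ne_top _), EReal.toReal_coe,
        ← enorm_neg]
      exact Real.ofReal_le_enorm _
  have hpos : ∀ Q ∈ M, ∀ t ∈ Finset.Icc 1 (T + 1), ∫⁻ ω, (W t ω).toENNReal ∂Q < ⊤ := by
    intro Q hQ t ht
    have := (hM Q hQ).1
    rw [Finset.mem_Icc] at ht
    obtain ⟨ht1, ht2⟩ := ht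
    induction t, ht1 using Nat.le_induction with
    | base =>
      simp only [hW1]
      rw [lintegral_const]
      exact ENNReal.mul_lt_top (by simp [lt_top_iff_ne_top]) (measure_lt_top _ _)
    | succ k hk ih =>
      exact (hW k (Finset.mem_Icc.2 ⟨hk, by omega⟩)).lintegral_pos_lt_top (F.le k)
        (hM Q hQ).2 hQ (hneg Q hQ _ (Finset.mem_Icc.2 ⟨by omega, ht2⟩)) (ih (by omega))
  have hfin : ∀ t ∈ Finset.Icc 1 (T + 1), ∀ᵐ ω ∂P, W t ω ≠ ⊤ ∧ W t ω ≠ ⊥ := by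
    intro t ht
    refine hnull {ω | W t ω ≠ ⊤ ∧ W t ω ≠ ⊥}ᶜ ?_ fun Q hQ =>
      ae_finite_of_lintegral_lt_top (hmeas t ht) (hpos Q hQ t ht) (hneg Q hQ t ht)
    have := hmeas t ht
    exact ((this (measurableSet_singleton ⊤).compl).inter
      (this (measurableSet_singleton ⊥).compl)).compl
  have hsub : ∀ {t}, t ∈ Finset.Icc 1 T →
      t ∈ Finset.Icc 1 (T + 1) ∧ t + 1 ∈ Finset.Icc 1 (T + 1) := by
    intro t ht
    rw [Finset.mem_Icc] at ht
    constructor <;> rw [Finset.mem_Icc] <;> omega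
  refine ⟨fun t ω => (W t ω).toReal, ⟨fun t ht Q hQ => ?_, fun t ht => ?_, fun t ht Q hQ => ?_,
    fun t ht y hy hle => ?_⟩, ?_, ?_⟩
  · exact integrable_toReal_of_lintegral_lt_top (hmeas t ht) (hpos Q hQ t ht) (hneg Q hQ t ht)
  · obtain ⟨L, -, hm, -⟩ := hW t ht
    exact hm.ereal_toReal
  · have := (hM Q hQ).1
    obtain ⟨Y, hY⟩ := (hW t ht).exists_version hQ
    have hs := hsub ht
    filter_upwards [(hW t ht).version_le (F.le t) (hM Q hQ).2 hQ hY,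
      hY.ae_eq_condExp (F.le t) (hmeas _ hs.2) (hpos Q hQ _ hs.2) (hneg Q hQ _ hs.2),
      (hM Q hQ).2.ae_le (hfin t hs.1)] with ω h1 h2 h3
    rw [h2, ← EReal.coe_toReal h3.1 h3.2] at h1
    exact EReal.coe_le_coe_iff.1 h1
  · have hs := hsub ht
    have := (hW t ht).le_of_version_le (Y := fun ω => (y ω : EReal))
      (measurable_coe_real_ereal.comp hy) (fun Q hQ => by
        have := (hM Q hQ).1
        obtain ⟨Y, hY⟩ := (hW t ht).exists_version hQ
        refine ⟨Y, hY, ?_⟩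
        filter_upwards [hle Q hQ,
          hY.ae_eq_condExp (F.le t) (hmeas _ hs.2) (hpos Q hQ _ hs.2) (hneg Q hQ _ hs.2)]
          with ω h1 h2
        rw [h2]
        exact EReal.coe_le_coe_iff.2 h1)
    filter_upwards [this, hfin t hs.1] with ω h1 h2
    rw [← EReal.coe_toReal h2.1 h2.2] at h1
    exact EReal.coe_le_coe_iff.1 h1
  · ext ω; simp [hWT]
  · ext ω; simp [hW1]

/-- Comparison principle: the defining minimality propagates linear inequalities, with nonnegative
coefficients and a constant, from the terminal values to all earlier times. -/
lemma IsRobustProcess.le_comb {m0 : MeasurableSpace Ω} {P : Measure Ω}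
    {M : Set (Measure Ω)} (hM : ∀ Q ∈ M, IsProbabilityMeasure Q ∧ Q ≪ P)
    {F : Filtration ℕ m0} {T : ℕ} {u v w : ℕ → Ω → ℝ} (hu : IsRobustProcess P M F T u)
    (hv : IsRobustProcess P M F T v) (hw : IsRobustProcess P M F T w) {a b c : ℝ} (ha : 0 ≤ a)
    (hb : 0 ≤ b) (h : ∀ᵐ ω ∂P, u (T + 1) ω ≤ a * v (T + 1) ω + b * w (T + 1) ω + c)
    {t : ℕ} (ht : 1 ≤ t) (htT : t ≤ T + 1) : ∀ᵐ ω ∂P, u t ω ≤ a * v t ω + b * w t ω + c := by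
  refine Nat.decreasingInduction' (P := fun t => ∀ᵐ ω ∂P, u t ω ≤ a * v t ω + b * w t ω + c)
      (fun k hk1 hk2 ih => ?_) htT h
  have hk : k ∈ Finset.Icc 1 T := Finset.mem_Icc.2 ⟨by omega, by omega⟩
  have hk' : k + 1 ∈ Finset.Icc 1 (T + 1) := Finset.mem_Icc.2 ⟨by omega, by omega⟩
  refine hu.le_of_condExp_le k hk (fun ω => a * v k ω + b * w k ω + c) ?_ fun Q hQ => ?_
  · exact (((hv.measurable k hk).const_mul a).add ((hw.measurable k hk).const_mul b)).add_const c
  · have := (hM Q hQ).1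
    have iu := hu.integrable _ hk' Q hQ
    have iv := (hv.integrable _ hk' Q hQ).smul a
    have iw := (hw.integrable _ hk' Q hQ).smul b
    have ic : Integrable (fun _ : Ω => c) Q := integrable_const c
    have h1 : Q[u (k + 1) | F k] ≤ᵐ[Q] Q[a • v (k + 1) + b • w (k + 1) + (fun _ => c) | F k] :=
      condExp_mono iu ((iv.add iw).add ic) ((hM Q hQ).2.ae_le ih)
    filter_upwards [h1, condExp_add (iv.add iw) ic (F k), condExp_add iv iw (F k),
      condExp_smul a (v (k + 1)) (F k) (μ := Q), condExp_smul b (w (k + 1)) (F k) (μ := Q),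
      hv.condExp_le k hk Q hQ, hw.condExp_le k hk Q hQ] with ω e1 e2 e3 e4 e5 e6 e7
    rw [e2, Pi.add_apply, e3, Pi.add_apply, e4, e5, condExp_const (F.le k)] at e1
    simp only [Pi.smul_apply, smul_eq_mul] at e1
    nlinarith [mul_le_mul_of_nonneg_left e6 ha, mul_le_mul_of_nonneg_left e7 hb]

/-- By the tower property, the composite functional dominates the expectation under each
`Q ∈ M`. -/
lemma IsRobustProcess.integral_le {m0 : MeasurableSpace Ω} {P Q : Measure Ω}
    [IsProbabilityMeasure Q] {M : Set (Measure Ω)} (hQ : Q ∈ M)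
    {F : Filtration ℕ m0} {T : ℕ} {w : ℕ → Ω → ℝ} (hw : IsRobustProcess P M F T w) {t : ℕ}
    (ht : 1 ≤ t) (htT : t ≤ T + 1) : ∫ ω, w t ω ∂Q ≤ ∫ ω, w 1 ω ∂Q := by
  induction t, ht using Nat.le_induction with
  | base => exact le_rfl
  | succ k hk ih =>
    have hk' : k ∈ Finset.Icc 1 T := Finset.mem_Icc.2 ⟨by omega, by omega⟩
    refine le_trans ?_ (ih (by omega))
    rw [← integral_condExp (F.le k)]
    exact integral_mono_ae integrable_condExp
      (hw.integrable k (Finset.mem_Icc.2 ⟨by omega, by omega⟩) Q hQ) (hw.condExp_le k hk' Q hQ)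

/-! ### The converse Hölder inequality -/

lemma le_rpow_of_le_mul_rpow {I C : ℝ≥0∞} (hI : I ≠ ⊤) {p q : ℝ} (hpq : p.HolderConjugate q)
    (h : I ≤ C * I ^ (1 / p)) : I ≤ C ^ q := by
  rcases eq_or_ne I 0 with rfl | h0
  · simp
  have hI' : I ^ (1 / p) ≠ ⊤ := ENNReal.rpow_ne_top_of_nonneg (by simp [hpq.pos.le]) hI
  have hI0 : I ^ (1 / p) ≠ 0 := by simp [h0, hI]
  have h1 : I ^ (1 / q) ≤ C := by
    refine (ENNReal.mul_le_mul_iff_left hI0 hI').1 ?_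
    rw [← ENNReal.rpow_add _ _ h0 hI]
    have : 1 / q + 1 / p = 1 := by
      have := hpq.inv_add_inv_eq_one
      simp only [one_div]; linarith
    rwa [this, ENNReal.rpow_one]
  calc I = (I ^ (1 / q)) ^ q := by
        rw [← ENNReal.rpow_mul, one_div_mul_cancel hpq.symm.pos.ne', ENNReal.rpow_one]
    _ ≤ C ^ q := ENNReal.rpow_le_rpow h1 hpq.symm.pos.le

/-- Converse Hölder inequality: a bound on the pairings of `f` with the bounded functions bounds
the `L_q` seminorm of `f`. For `q = ∞` it is tested with the indicator of `{f > C}`, for `q < ∞`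
with the powers `(min f n) ^ (q - 1)`. -/
lemma eLpNorm_le_of_forall_lintegral_mul_le {m0 : MeasurableSpace Ω} {μ : Measure Ω}
    [IsFiniteMeasure μ] {p q : ℝ≥0∞} (hp : p ≠ ⊤) (hp1 : 1 ≤ p) [hpq : ENNReal.HolderConjugate p q]
    {f : Ω → ℝ≥0∞} (hf : Measurable f) {C : ℝ≥0∞} (hC : C ≠ ⊤)
    (h : ∀ g : Ω → ℝ≥0∞, Measurable g → (∃ n : ℝ≥0∞, n ≠ ⊤ ∧ ∀ ω, g ω ≤ n) →
      ∫⁻ ω, f ω * g ω ∂μ ≤ C * eLpNorm g p μ) :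
    eLpNorm f q μ ≤ C := by
  rcases hp1.eq_or_lt with rfl | hp1
  · obtain rfl : q = ⊤ := by simpa using hpq.conj_eq
    set S := {ω | C < f ω}
    have hS : MeasurableSet S := measurableSet_lt measurable_const hf
    have h1 := h (S.indicator fun _ => 1) (measurable_const.indicator hS)
      ⟨1, by simp, fun ω => by by_cases hω : ω ∈ S <;> simp [hω]⟩
    have h2 : ∫⁻ ω in S, f ω ∂μ ≤ ∫⁻ _ in S, C ∂μ := by
      rw [setLIntegral_const, ← lintegral_indicator hS]
      refine le_trans (le_of_eq ?_) (h1.trans (le_of_eq ?_))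
      · congr with ω; by_cases hω : ω ∈ S <;> simp [hω]
      · rw [eLpNorm_one_eq_lintegral_enorm]
        have : ∀ ω, ‖S.indicator (fun _ => (1 : ℝ≥0∞)) ω‖ₑ = S.indicator (fun _ => 1) ω :=
          fun ω => rfl
        simp [this, lintegral_indicator hS]
    have h3 : (fun _ => C) =ᵐ[μ.restrict S] f := by
      refine ae_eq_of_ae_le_of_lintegral_le ?_ ?_ hf.aemeasurable h2
      · exact (ae_restrict_mem hS).mono fun ω hω => le_of_lt hω
      · rw [setLIntegral_const]; exact ENNReal.mul_ne_top hC (measure_ne_top _ _)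
    have h4 : ∀ᵐ ω ∂μ, ω ∉ S := by
      filter_upwards [(ae_restrict_iff' hS).1 h3] with ω hω hωS
      exact absurd (hω hωS) (ne_of_lt hωS)
    rw [eLpNorm_exponent_top]
    refine essSup_le_of_ae_le _ ?_
    filter_upwards [h4] with ω hω using not_lt.1 hω
  · have hq : q ≠ ⊤ := ((ENNReal.HolderConjugate.lt_top_iff_one_lt q p).2 hp1).ne
    have hq0 : q ≠ 0 := ENNReal.HolderConjugate.ne_zero q p
    have hr : p.toReal.HolderConjugate q.toReal := ENNReal.HolderConjugate.toReal_of_ne_top hp hq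
    set a := p.toReal
    set b := q.toReal
    have hb0 : 0 < b := hr.symm.pos
    have hb1 : 0 < b - 1 := hr.symm.sub_one_pos
    have key : ∀ n : ℕ, ∫⁻ ω, (min (f ω) n) ^ b ∂μ ≤ C ^ b := by
      intro n
      have hm : Measurable fun ω => min (f ω) (n : ℝ≥0∞) := hf.min measurable_const
      have hn : ∀ {c : ℝ}, 0 ≤ c → ∀ ω, (min (f ω) (n : ℝ≥0∞)) ^ c ≤ (n : ℝ≥0∞) ^ c := fun hc ω =>
        ENNReal.rpow_le_rpow (min_le_right _ _) hc
      have hn' : ∀ {c : ℝ}, 0 ≤ c → (n : ℝ≥0∞) ^ c ≠ ⊤ := fun hc =>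
        ENNReal.rpow_ne_top_of_nonneg hc (by simp)
      refine le_rpow_of_le_mul_rpow ?_ hr ?_
      · refine ((lintegral_mono (hn hb0.le)).trans_lt ?_).ne
        rw [lintegral_const]
        exact ENNReal.mul_lt_top (hn' hb0.le).lt_top (measure_lt_top _ _)
      · calc ∫⁻ ω, (min (f ω) n) ^ b ∂μ ≤ ∫⁻ ω, f ω * (min (f ω) n) ^ (b - 1) ∂μ := by
              refine lintegral_mono fun ω => ?_
              have e : (min (f ω) (n : ℝ≥0∞)) ^ b
                  = min (f ω) n * (min (f ω) n) ^ (b - 1) := by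
                conv_lhs => rw [show b = 1 + (b - 1) by ring]
                rw [ENNReal.rpow_add_of_nonneg _ _ zero_le_one hb1.le, ENNReal.rpow_one]
              rw [e]
              gcongr
              exact min_le_left _ _
          _ ≤ C * eLpNorm (fun ω => (min (f ω) (n : ℝ≥0∞)) ^ (b - 1)) p μ :=
              h _ (hm.pow_const _) ⟨_, hn' hb1.le, hn hb1.le⟩
          _ = _ := by
              rw [eLpNorm_eq_lintegral_rpow_enorm_toReal (by positivity) hp]
              simp only [enorm_eq_self, ← ENNReal.rpow_mul]
              congr! 5
              exact hr.symm.sub_one_mul_conj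
    have hlim : ∫⁻ ω, f ω ^ b ∂μ ≤ C ^ b := by
      refine le_of_tendsto' (lintegral_tendsto_of_tendsto_of_monotone
        (f := fun (n : ℕ) ω => (min (f ω) (n : ℝ≥0∞)) ^ b) (fun n => ?_) ?_ ?_) key
      · exact ((hf.min measurable_const).pow_const _).aemeasurable
      · refine .of_forall fun ω m n hmn => ?_
        have : (m : ℝ≥0∞) ≤ n := by exact_mod_cast hmn
        exact ENNReal.rpow_le_rpow (min_le_min_left _ this) hb0.le
      · refine .of_forall fun ω => ?_
        refine ((ENNReal.continuous_rpow_const (y := b)).tendsto _).comp ?_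
        have := (tendsto_const_nhds (x := f ω)).min ENNReal.tendsto_nat_nhds_top
        simpa using this
    rw [eLpNorm_eq_lintegral_rpow_enorm_toReal (by positivity) hq]
    simp only [enorm_eq_self]
    calc (∫⁻ ω, f ω ^ b ∂μ) ^ (1 / b) ≤ (C ^ b) ^ (1 / b) :=
          ENNReal.rpow_le_rpow hlim (by positivity)
      _ = C := by rw [← ENNReal.rpow_mul, mul_one_div_cancel hb0.ne', ENNReal.rpow_one]

/-- The `L_q` norm of a nonnegative `ζ` is bounded by the norm of the functional it induces. -/
lemma norm_le_of_forall_integral_le {m0 : MeasurableSpace Ω} {P : Measure Ω}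
    [IsFiniteMeasure P] {p q : ℝ≥0∞} [hp1 : Fact (1 ≤ p)] [Fact (1 ≤ q)] (hp : p ≠ ⊤)
    [ENNReal.HolderConjugate p q] {C : ℝ} (hC : 0 ≤ C) (ζ : Lp ℝ q P) (hζ : 0 ≤ᵐ[P] (ζ : Ω → ℝ))
    (h : ∀ Z : Lp ℝ p P, ∫ ω, Z ω * ζ ω ∂P ≤ C * ‖Z‖) : ‖ζ‖ ≤ C := by
  have hζm : Measurable (ζ : Ω → ℝ) := (Lp.stronglyMeasurable ζ).measurable
  have key : eLpNorm (fun ω => ENNReal.ofReal (ζ ω)) q P ≤ ENNReal.ofReal C := by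
    refine eLpNorm_le_of_forall_lintegral_mul_le hp hp1.out hζm.ennreal_ofReal
      ENNReal.ofReal_ne_top fun g hg ⟨n, hn, hgn⟩ => ?_
    have hgt : ∀ ω, g ω ≠ ⊤ := fun ω => ((hgn ω).trans_lt hn.lt_top).ne
    have hgL : MemLp (fun ω => (g ω).toReal) p P := by
      refine MemLp.of_bound hg.ennreal_toReal.aestronglyMeasurable n.toReal (.of_forall fun ω => ?_)
      rw [Real.norm_of_nonneg ENNReal.toReal_nonneg]
      exact ENNReal.toReal_mono hn (hgn ω)
    have hnorm : ENNReal.ofReal ‖hgL.toLp _‖ = eLpNorm g p P := by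
      rw [Lp.norm_toLp, ENNReal.ofReal_toReal hgL.2.ne]
      refine eLpNorm_congr_enorm_ae (.of_forall fun ω => ?_)
      rw [Real.enorm_of_nonneg ENNReal.toReal_nonneg, ENNReal.ofReal_toReal (hgt ω), enorm_eq_self]
    have hint : Integrable (fun ω => (g ω).toReal * ζ ω) P :=
      hgL.integrable_mul (Lp.memLp ζ)
    calc ∫⁻ ω, ENNReal.ofReal (ζ ω) * g ω ∂P
        = ∫⁻ ω, ENNReal.ofReal ((g ω).toReal * ζ ω) ∂P := by
          refine lintegral_congr fun ω => ?_
          rw [ENNReal.ofReal_mul ENNReal.toReal_nonneg, ENNReal.ofReal_toReal (hgt ω), mul_comm]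
      _ = ENNReal.ofReal (∫ ω, (g ω).toReal * ζ ω ∂P) := by
          rw [ofReal_integral_eq_lintegral_ofReal hint]
          filter_upwards [hζ] with ω hω using mul_nonneg ENNReal.toReal_nonneg hω
      _ = ENNReal.ofReal (∫ ω, hgL.toLp _ ω * ζ ω ∂P) := by
          congr 1
          refine integral_congr_ae ?_
          filter_upwards [hgL.coeFn_toLp] with ω hω
          rw [hω]
      _ ≤ ENNReal.ofReal (C * ‖hgL.toLp _‖) := ENNReal.ofReal_le_ofReal (h _)
      _ = ENNReal.ofReal C * eLpNorm g p P := by rw [ENNReal.ofReal_mul hC, hnorm]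
  rw [Lp.norm_def]
  refine ENNReal.toReal_le_of_le_ofReal hC (le_trans (le_of_eq ?_) key)
  refine eLpNorm_congr_enorm_ae ?_
  filter_upwards [hζ] with ω hω
  rw [Real.enorm_of_nonneg hω, enorm_eq_self]

/-! ### Monotone functionals and Riesz representation -/

/-- A positively homogeneous monotone functional on a Banach lattice is bounded above on the unit
ball: otherwise `∑ 2⁻ⁿ |Zₙ|`, with `‖Zₙ‖ ≤ 1` and `N Zₙ > 4ⁿ`, would have infinite value. -/
lemma exists_le_mul_norm_of_monotone {E : Type*} [NormedAddCommGroup E] [Lattice E]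
    [HasSolidNorm E] [IsOrderedAddMonoid E] [NormedSpace ℝ E] [PosSMulMono ℝ E]
    [CompleteSpace E] {N : E → ℝ} (hmono : Monotone N)
    (hhom : ∀ c : ℝ, 0 < c → ∀ x, N (c • x) = c * N x) :
    ∃ C : ℝ, 0 ≤ C ∧ ∀ x, N x ≤ C * ‖x‖ := by
  have h0 : N 0 = 0 := by have := hhom 2 two_pos 0; simp at this; linarith
  by_contra! hcon
  have hex : ∀ n : ℕ, ∃ x : E, ‖x‖ ≤ 1 ∧ (4 : ℝ) ^ n < N x := by
    intro n
    obtain ⟨x, hx⟩ := hcon (4 ^ n) (by positivity)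
    have hx0 : 0 < ‖x‖ := by
      refine norm_pos_iff.2 fun h => ?_
      simp [h, h0] at hx
    refine ⟨‖x‖⁻¹ • x, ?_, ?_⟩
    · rw [norm_smul, norm_inv, norm_norm, inv_mul_cancel₀ hx0.ne']
    · rw [hhom _ (inv_pos.2 hx0), inv_mul_eq_div, lt_div_iff₀ hx0]
      exact hx
  choose x hx1 hx2 using hex
  have hsum : Summable fun n => (1 / 2 : ℝ) ^ n • |x n| := by
    refine Summable.of_norm_bounded summable_geometric_two fun n => ?_
    rw [norm_smul, norm_abs_eq_norm, norm_pow, Real.norm_of_nonneg (by norm_num)]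
    exact mul_le_of_le_one_right (by positivity) (hx1 n)
  have hbig : ∀ n : ℕ, (2 : ℝ) ^ n < N (∑' n, (1 / 2 : ℝ) ^ n • |x n|) := by
    intro n
    have h1 : (1 / 2 : ℝ) ^ n • |x n| ≤ ∑' n, (1 / 2 : ℝ) ^ n • |x n| :=
      hsum.le_tsum n fun j _ => smul_nonneg (by positivity) (abs_nonneg _)
    have h2 := hmono h1
    rw [hhom _ (by positivity)] at h2
    have h3 : N (x n) ≤ N |x n| := hmono (le_abs_self _)
    calc (2 : ℝ) ^ n = (1 / 2) ^ n * 4 ^ n := by rw [← mul_pow]; norm_num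
      _ < (1 / 2) ^ n * N (x n) := by have := hx2 n; gcongr
      _ ≤ (1 / 2) ^ n * N |x n| := by gcongr
      _ ≤ _ := h2
  obtain ⟨n, hn⟩ := pow_unbounded_of_one_lt (N (∑' n, (1 / 2 : ℝ) ^ n • |x n|)) one_lt_two
  exact lt_asymm hn (hbig n)

section Riesz

variable {m0 : MeasurableSpace Ω} {P : Measure Ω} [IsFiniteMeasure P] {p : ℝ≥0∞}

lemma memLp_coe_simpleFunc (φ : SimpleFunc Ω NNReal) : MemLp (fun ω => (φ ω : ℝ)) p P :=
  (φ.map NNReal.toReal).memLp_of_isFiniteMeasure p P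

lemma indicatorConstLp_one_nonneg {s : Set Ω} (hs : MeasurableSet s) :
    0 ≤ indicatorConstLp p hs (measure_ne_top P s) (1 : ℝ) := by
  rw [← Lp.coeFn_nonneg]
  filter_upwards [indicatorConstLp_coeFn (p := p) (hs := hs) (hμs := measure_ne_top P s)
    (c := (1 : ℝ))] with ω hω
  rw [hω]
  exact indicator_nonneg (fun _ _ => zero_le_one) ω

lemma tendsto_measure_accumulate_symmDiff {A : ℕ → Set Ω} (hA : ∀ n, MeasurableSet (A n)) :
    Filter.Tendsto (fun n => P (symmDiff (accumulate A n) (⋃ n, A n))) Filter.atTop (𝓝 0) := by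
  have hm : ∀ n, MeasurableSet (accumulate A n) := fun n =>
    MeasurableSet.biUnion (to_countable _) fun i _ => hA i
  have hsub : ∀ n, accumulate A n ⊆ ⋃ n, A n := fun n => accumulate_subset_iUnion n
  have h1 : ∀ n, P (symmDiff (accumulate A n) (⋃ n, A n)) = P (⋃ n, A n) - P (accumulate A n) := by
    intro n
    rw [symmDiff_of_le (hsub n)]
    exact measure_sdiff (hsub n) (hm n).nullMeasurableSet (measure_ne_top _ _)
  simp_rw [h1]
  have h2 := ENNReal.Tendsto.sub (tendsto_const_nhds (x := P (⋃ n, A n)))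
    (tendsto_measure_iUnion_accumulate (μ := P) (f := A)) (.inl (measure_ne_top _ _))
  simpa using h2

variable [Fact (1 ≤ p)]

/-- The measure `A ↦ f(1_A)` induced by a positive functional `f` on `L_p`, `p < ∞`. -/
noncomputable def measureOfFunctional (hp : p ≠ ⊤) (f : Lp ℝ p P →L[ℝ] ℝ)
    (hf : ∀ Z, 0 ≤ Z → 0 ≤ f Z) : Measure Ω :=
  Measure.ofMeasurable
    (fun s hs => ENNReal.ofReal (f (indicatorConstLp p hs (measure_ne_top P s) 1)))
    (by simp)
    (by
      intro A hA hdisj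
      have hm : ∀ n, MeasurableSet (accumulate A n) := fun n =>
        MeasurableSet.biUnion (to_countable _) fun i _ => hA i
      have hpart : ∀ n, ∑ i ∈ Finset.range (n + 1),
          ENNReal.ofReal (f (indicatorConstLp p (hA i) (measure_ne_top P _) 1))
          = ENNReal.ofReal (f (indicatorConstLp p (hm n) (measure_ne_top P _) 1)) := by
        intro n
        induction n with
        | zero =>
          have : accumulate A 0 = A 0 := by simp
          simp [this]
        | succ n ih =>
          have hd : Disjoint (accumulate A n) (A (n + 1)) :=
            disjoint_accumulate hdisj n.lt_succ_self
          rw [Finset.sum_range_succ, ih, ← ENNReal.ofReal_add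
            (hf _ (indicatorConstLp_one_nonneg _)) (hf _ (indicatorConstLp_one_nonneg _)),
            ← map_add, ← indicatorConstLp_disjoint_union (hm n) (hA (n + 1))
              (measure_ne_top P _) (measure_ne_top P _) hd 1]
          congr 3
          exact (accumulate_succ A n).symm
      refine tendsto_nhds_unique ?_ ((ENNReal.tendsto_nat_tsum _).comp
        (Filter.tendsto_add_atTop_nat 1))
      simp only [Function.comp_def, hpart]
      refine (ENNReal.continuous_ofReal.tendsto _).comp ((f.continuous.tendsto _).comp ?_)
      exact tendsto_indicatorConstLp_set hp (tendsto_measure_accumulate_symmDiff hA))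

lemma measureOfFunctional_apply (hp : p ≠ ⊤) (f : Lp ℝ p P →L[ℝ] ℝ)
    (hf : ∀ Z, 0 ≤ Z → 0 ≤ f Z) {s : Set Ω} (hs : MeasurableSet s) :
    measureOfFunctional hp f hf s
      = ENNReal.ofReal (f (indicatorConstLp p hs (measure_ne_top P s) 1)) :=
  Measure.ofMeasurable_apply s hs

lemma lintegral_simpleFunc_measureOfFunctional (hp : p ≠ ⊤) (f : Lp ℝ p P →L[ℝ] ℝ)
    (hf : ∀ Z, 0 ≤ Z → 0 ≤ f Z) (φ : SimpleFunc Ω NNReal) (Z : Lp ℝ p P)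
    (hZ : Z =ᵐ[P] fun ω => (φ ω : ℝ)) :
    ∫⁻ ω, φ ω ∂(measureOfFunctional hp f hf) = ENNReal.ofReal (f Z) := by
  induction φ using SimpleFunc.induction generalizing Z with
  | @const c s hs =>
    have e : (fun ω => ((SimpleFunc.piecewise s hs (SimpleFunc.const Ω c) (SimpleFunc.const Ω 0)
        : SimpleFunc Ω NNReal) ω : ℝ≥0∞)) = s.indicator fun _ => (c : ℝ≥0∞) := by
      ext ω; by_cases hω : ω ∈ s <;> simp [hω]
    have hZ' : Z = (c : ℝ) • indicatorConstLp p hs (measure_ne_top P s) (1 : ℝ) := by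
      refine Lp.ext ?_
      filter_upwards [hZ,
        Lp.coeFn_smul (c : ℝ) (indicatorConstLp p hs (measure_ne_top P s) (1 : ℝ)),
        indicatorConstLp_coeFn (p := p) (hs := hs) (hμs := measure_ne_top P s) (c := (1 : ℝ))]
        with ω h1 h2 h3
      rw [h1, h2, Pi.smul_apply, h3]
      by_cases hω : ω ∈ s <;> simp [hω]
    rw [hZ', e, lintegral_indicator hs, setLIntegral_const, measureOfFunctional_apply hp f hf hs,
      map_smul, smul_eq_mul, ENNReal.ofReal_mul (NNReal.coe_nonneg c), ENNReal.ofReal_coe_nnreal]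
  | @add φ ψ _ hφ hψ =>
    have mφ := memLp_coe_simpleFunc (P := P) (p := p) φ
    have mψ := memLp_coe_simpleFunc (P := P) (p := p) ψ
    have hnn : ∀ (χ : SimpleFunc Ω NNReal) (h : MemLp (fun ω => (χ ω : ℝ)) p P),
        0 ≤ h.toLp _ := by
      intro χ h
      rw [← Lp.coeFn_nonneg]
      filter_upwards [h.coeFn_toLp] with ω hω
      rw [hω]
      exact NNReal.coe_nonneg _
    have hZ' : Z = mφ.toLp _ + mψ.toLp _ := by
      refine Lp.ext ?_
      filter_upwards [hZ, Lp.coeFn_add (mφ.toLp _) (mψ.toLp _), mφ.coeFn_toLp, mψ.coeFn_toLp]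
        with ω h1 h2 h3 h4
      rw [h1, h2, Pi.add_apply, h3, h4]
      simp
    rw [hZ', map_add, ENNReal.ofReal_add (hf _ (hnn φ mφ)) (hf _ (hnn ψ mψ)),
      ← hφ _ mφ.coeFn_toLp, ← hψ _ mψ.coeFn_toLp, ← lintegral_add_left (by fun_prop)]
    simp

/-- The integral of `g` is the supremum of the integrals of the simple functions below it, which
are values of `f`. -/
lemma lintegral_measureOfFunctional_le (hp : p ≠ ⊤) (f : Lp ℝ p P →L[ℝ] ℝ)
    (hf : ∀ Z, 0 ≤ Z → 0 ≤ f Z) (g : Ω → ℝ≥0∞) :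
    ∫⁻ ω, g ω ∂(measureOfFunctional hp f hf) ≤ ENNReal.ofReal ‖f‖ * eLpNorm g p P := by
  rw [lintegral_eq_nnreal]
  refine iSup₂_le fun φ hφ => ?_
  have mφ := memLp_coe_simpleFunc (P := P) (p := p) φ
  have h1 := lintegral_simpleFunc_measureOfFunctional hp f hf φ _ mφ.coeFn_toLp
  rw [← SimpleFunc.lintegral_eq_lintegral]
  simp only [SimpleFunc.coe_map, Function.comp_apply]
  rw [h1]
  calc ENNReal.ofReal (f (mφ.toLp _)) ≤ ENNReal.ofReal (‖f‖ * ‖mφ.toLp _‖) :=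
        ENNReal.ofReal_le_ofReal ((Real.le_norm_self _).trans (f.le_opNorm _))
    _ = ENNReal.ofReal ‖f‖ * eLpNorm (fun ω => (φ ω : ℝ)) p P := by
        rw [ENNReal.ofReal_mul (norm_nonneg _), Lp.norm_toLp, ENNReal.ofReal_toReal mφ.2.ne]
    _ ≤ ENNReal.ofReal ‖f‖ * eLpNorm g p P := by
        gcongr
        refine eLpNorm_mono_enorm fun ω => ?_
        rw [Real.enorm_of_nonneg (NNReal.coe_nonneg _), ENNReal.ofReal_coe_nnreal, enorm_eq_self]
        exact hφ ω

/-- Riesz representation of positive functionals on `L_p`, `p < ∞`. The density is the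
Radon–Nikodym derivative of `A ↦ f(1_A)`; it is in `L_q` by the converse Hölder inequality, and the
representation extends from indicators to `L_p` by density. -/
lemma exists_forall_eq_integral_of_nonneg {q : ℝ≥0∞} [Fact (1 ≤ q)]
    [ENNReal.HolderConjugate p q] (hp : p ≠ ⊤) (f : Lp ℝ p P →L[ℝ] ℝ)
    (hf : ∀ Z, 0 ≤ Z → 0 ≤ f Z) :
    ∃ ζ : Lp ℝ q P, ∀ Z : Lp ℝ p P, f Z = ∫ ω, Z ω * ζ ω ∂P := by
  set ν := measureOfFunctional hp f hf with hν
  have hνP : ν ≪ P := by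
    refine Measure.AbsolutelyContinuous.mk fun s hs hPs => ?_
    rw [hν, measureOfFunctional_apply hp f hf hs]
    have : indicatorConstLp p hs (measure_ne_top P s) (1 : ℝ) = 0 := by
      refine (Lp.eq_zero_iff_ae_eq_zero).2 ?_
      filter_upwards [indicatorConstLp_coeFn (p := p) (hs := hs) (hμs := measure_ne_top P s)
        (c := (1 : ℝ)), measure_eq_zero_iff_ae_notMem.1 hPs] with ω h1 h2
      simp [h1, h2]
    simp [this]
  have hνfin : IsFiniteMeasure ν :=
    ⟨by rw [hν, measureOfFunctional_apply hp f hf MeasurableSet.univ]; exact ENNReal.ofReal_lt_top⟩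
  have hζ : MemLp (fun ω => (ν.rnDeriv P ω).toReal) q P := by
    have h1 : eLpNorm (ν.rnDeriv P) q P ≤ ENNReal.ofReal ‖f‖ := by
      refine eLpNorm_le_of_forall_lintegral_mul_le hp Fact.out (Measure.measurable_rnDeriv ν P)
        ENNReal.ofReal_ne_top fun g hg _ => ?_
      rw [lintegral_rnDeriv_mul hνP hg.aemeasurable]
      exact lintegral_measureOfFunctional_le hp f hf g
    refine ⟨(Measure.measurable_rnDeriv ν P).ennreal_toReal.aestronglyMeasurable,
      (le_trans (le_of_eq ?_) h1).trans_lt ENNReal.ofReal_lt_top⟩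
    refine eLpNorm_congr_enorm_ae ?_
    filter_upwards [Measure.rnDeriv_lt_top ν P] with ω hω
    rw [Real.enorm_of_nonneg ENNReal.toReal_nonneg, ENNReal.ofReal_toReal hω.ne, enorm_eq_self]
  set ζ : Lp ℝ q P := hζ.toLp _
  have hB : ∀ Z : Lp ℝ p P, (ContinuousLinearMap.mul ℝ ℝ).lpPairing P p q Z ζ
      = ∫ ω, Z ω * ζ ω ∂P := fun Z => by
    rw [ContinuousLinearMap.lpPairing_eq_integral]; rfl
  refine ⟨ζ, fun Z => ?_⟩
  rw [← hB]
  refine Lp.induction hp (motive := fun Z =>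
    f Z = (ContinuousLinearMap.mul ℝ ℝ).lpPairing P p q Z ζ) ?_ ?_ ?_ Z
  · intro c s hs hPs
    have h1 : ((Lp.simpleFunc.indicatorConst p hs hPs.ne c : Lp.simpleFunc ℝ p P) : Lp ℝ p P)
        = c • indicatorConstLp p hs (measure_ne_top P s) (1 : ℝ) := by
      refine Lp.ext ?_
      rw [Lp.simpleFunc.coe_indicatorConst]
      filter_upwards [Lp.coeFn_smul c (indicatorConstLp p hs (measure_ne_top P s) (1 : ℝ)),
        indicatorConstLp_coeFn (p := p) (hs := hs) (hμs := measure_ne_top P s) (c := (1 : ℝ)),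
        indicatorConstLp_coeFn (p := p) (hs := hs) (hμs := measure_ne_top P s) (c := c)]
        with ω h1 h2 h3
      rw [h1, Pi.smul_apply, h2, h3]
      by_cases hω : ω ∈ s <;> simp [hω]
    rw [h1, map_smul, map_smul, smul_apply]
    congr 1
    rw [hB]
    have h2 : ∫ ω, indicatorConstLp p hs (measure_ne_top P s) (1 : ℝ) ω * ζ ω ∂P
        = ∫ ω in s, (ν.rnDeriv P ω).toReal ∂P := by
      rw [← integral_indicator hs]
      refine integral_congr_ae ?_
      filter_upwards [hζ.coeFn_toLp, indicatorConstLp_coeFn (p := p) (hs := hs)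
        (hμs := measure_ne_top P s) (c := (1 : ℝ))] with ω h1 h2
      rw [h2, h1]
      by_cases hω : ω ∈ s <;> simp [hω]
    rw [h2, Measure.setIntegral_toReal_rnDeriv hνP, measureReal_def, hν,
      measureOfFunctional_apply hp f hf hs,
      ENNReal.toReal_ofReal (hf _ (indicatorConstLp_one_nonneg hs))]
  · intro g h hg hh _ e1 e2
    rw [map_add, map_add, add_apply, e1, e2]
  · exact isClosed_eq f.continuous
      (((ContinuousLinearMap.mul ℝ ℝ).lpPairing P p q).flip ζ).continuous

end Riesz

/-! ### The dual set of a monotone sublinear functional -/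

section Dual

variable {m0 : MeasurableSpace Ω} {P : Measure Ω} {p q : ℝ≥0∞}

instance : PosSMulMono ℝ (Lp ℝ p P) :=
  PosSMulMono.of_smul_nonneg fun c hc Z hZ => by
    rw [← Lp.coeFn_nonneg] at hZ ⊢
    filter_upwards [hZ, Lp.coeFn_smul c Z] with ω h1 h2
    rw [h2]
    exact mul_nonneg hc h1

/-- `N` respects linear inequalities with nonnegative coefficients and a constant term. This is
monotonicity, sublinearity and `N (Z + c) ≤ N Z + c` in one property. -/
def IsSublinearRisk {m0 : MeasurableSpace Ω} {p : ℝ≥0∞} {P : Measure Ω} (N : Lp ℝ p P → ℝ) :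
    Prop :=
  ∀ (X Y Z : Lp ℝ p P) (a b c : ℝ), 0 ≤ a → 0 ≤ b →
    (∀ᵐ ω ∂P, X ω ≤ a * Y ω + b * Z ω + c) → N X ≤ a * N Y + b * N Z + c

/-- The set of all `ζ ∈ L_q` whose functional `Z ↦ ∫ Z ζ dP` is dominated by `N`. -/
def dualSet {m0 : MeasurableSpace Ω} {p : ℝ≥0∞} (q : ℝ≥0∞) {P : Measure Ω}
    (N : Lp ℝ p P → ℝ) : Set (Lp ℝ q P) :=
  {ζ | ∀ Z : Lp ℝ p P, ∫ ω, Z ω * ζ ω ∂P ≤ N Z}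

lemma integrable_mul_of_holderConjugate [ENNReal.HolderConjugate p q] (Z : Lp ℝ p P)
    (ζ : Lp ℝ q P) :
    Integrable (fun ω => Z ω * ζ ω) P :=
  (Lp.memLp Z).integrable_mul (Lp.memLp ζ)

lemma integral_mul_indicatorConstLp [IsFiniteMeasure P] {s : Set Ω} (hs : MeasurableSet s)
    (c : ℝ) (ζ : Ω → ℝ) :
    ∫ ω, indicatorConstLp p hs (measure_ne_top P s) c ω * ζ ω ∂P = c * ∫ ω in s, ζ ω ∂P := by
  rw [← integral_const_mul, ← integral_indicator hs]
  refine integral_congr_ae ?_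
  filter_upwards [indicatorConstLp_coeFn (p := p) (hs := hs) (hμs := measure_ne_top P s) (c := c)]
    with ω h
  rw [h]
  by_cases hω : ω ∈ s <;> simp [hω]

lemma convex_dualSet [ENNReal.HolderConjugate p q] (N : Lp ℝ p P → ℝ) : Convex ℝ (dualSet q N) := by
  intro ζ hζ η hη a b ha hb hab Z
  have h1 : ∫ ω, Z ω * (a • ζ + b • η : Lp ℝ q P) ω ∂P
      = a * ∫ ω, Z ω * ζ ω ∂P + b * ∫ ω, Z ω * η ω ∂P := by
    rw [← integral_const_mul, ← integral_const_mul, ← integral_add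
      ((integrable_mul_of_holderConjugate Z ζ).const_mul a)
      ((integrable_mul_of_holderConjugate Z η).const_mul b)]
    refine integral_congr_ae ?_
    filter_upwards [Lp.coeFn_add (a • ζ) (b • η), Lp.coeFn_smul a ζ, Lp.coeFn_smul b η]
      with ω h1 h2 h3
    rw [h1, Pi.add_apply, h2, h3]
    simp only [Pi.smul_apply, smul_eq_mul]
    ring
  rw [h1]
  calc a * ∫ ω, Z ω * ζ ω ∂P + b * ∫ ω, Z ω * η ω ∂P ≤ a * N Z + b * N Z := by
        gcongr
        · exact hζ Z
        · exact hη Z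
    _ = N Z := by rw [← add_mul, hab, one_mul]

lemma isClosed_dualSet (N : Lp ℝ p P → ℝ) :
    IsClosed[weakStarTopology p q P] (dualSet q N) := by
  rw [isClosed_induced_iff]
  refine ⟨{h | ∀ Z, h Z ≤ N Z}, ?_, rfl⟩
  simp only [ofPred_forall]
  exact isClosed_iInter fun Z => isClosed_le (continuous_apply Z) continuous_const

namespace IsSublinearRisk

variable {N : Lp ℝ p P → ℝ}

lemma le_const
    (hN : IsSublinearRisk N) {Z : Lp ℝ p P} {c : ℝ} (h : ∀ᵐ ω ∂P, Z ω ≤ c) : N Z ≤ c := by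
  have := hN Z Z Z 0 0 c le_rfl le_rfl (by simpa using h)
  simpa using this

lemma mono (hN : IsSublinearRisk N) : Monotone N := by
  intro Y Z h
  have := hN Y Z Z 1 0 0 zero_le_one le_rfl (by
    filter_upwards [(Lp.coeFn_le Y Z).2 h] with ω hω
    simpa using hω)
  simpa using this

lemma add_le
    (hN : IsSublinearRisk N) (Y Z : Lp ℝ p P) : N (Y + Z) ≤ N Y + N Z := by
  have := hN (Y + Z) Y Z 1 1 0 zero_le_one zero_le_one (by
    filter_upwards [Lp.coeFn_add Y Z] with ω h
    rw [h, Pi.add_apply]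
    linarith)
  simpa using this

lemma smul_le
    (hN : IsSublinearRisk N) {c : ℝ} (hc : 0 ≤ c) (Z : Lp ℝ p P) : N (c • Z) ≤ c * N Z := by
  have := hN (c • Z) Z Z c 0 0 hc le_rfl (by
    filter_upwards [Lp.coeFn_smul c Z] with ω h
    simp [h])
  simpa using this

lemma smul_eq
    (hN : IsSublinearRisk N) {c : ℝ} (hc : 0 < c) (Z : Lp ℝ p P) : N (c • Z) = c * N Z := by
  refine le_antisymm (hN.smul_le hc.le Z) ?_
  have := hN.smul_le (inv_nonneg.2 hc.le) (c • Z)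
  rw [smul_smul, inv_mul_cancel₀ hc.ne', one_smul] at this
  calc c * N Z ≤ c * (c⁻¹ * N (c • Z)) := by gcongr
    _ = N (c • Z) := by field_simp

lemma isDensity [IsProbabilityMeasure P] [Fact (1 ≤ q)]
    (hN : IsSublinearRisk N) {ζ : Lp ℝ q P} (hζ : ζ ∈ dualSet q N) : IsDensity P ζ := by
  have hi : Integrable (ζ : Ω → ℝ) P := (Lp.memLp ζ).integrable Fact.out
  have key : ∀ (s : Set Ω) (hs : MeasurableSet s) (c d : ℝ), (∀ ω, s.indicator (fun _ => c) ω ≤ d) →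
      c * ∫ ω in s, ζ ω ∂P ≤ d := by
    intro s hs c d h
    rw [← integral_mul_indicatorConstLp (p := p) hs]
    refine (hζ _).trans (hN.le_const ?_)
    filter_upwards [indicatorConstLp_coeFn (p := p) (hs := hs) (hμs := measure_ne_top P s)
      (c := c)] with ω hω
    rw [hω]
    exact h ω
  constructor
  · refine ae_nonneg_of_forall_setIntegral_nonneg hi fun s hs _ => ?_
    have := key s hs (-1) 0 fun ω => by by_cases hω : ω ∈ s <;> simp [hω]
    linarith
  · have h1 := key univ MeasurableSet.univ 1 1 (by simp)
    have h2 := key univ MeasurableSet.univ (-1) (-1) (by simp)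
    rw [setIntegral_univ] at h1 h2
    linarith

lemma isBounded_dualSet [IsProbabilityMeasure P] [Fact (1 ≤ p)] [Fact (1 ≤ q)]
    [ENNReal.HolderConjugate p q] (hN : IsSublinearRisk N) (hp : p ≠ ⊤) :
    Bornology.IsBounded (dualSet q N) := by
  obtain ⟨C, hC, hle⟩ := exists_le_mul_norm_of_monotone hN.mono fun c hc x => hN.smul_eq hc x
  refine isBounded_iff_forall_norm_le.2 ⟨C, fun ζ hζ => ?_⟩
  exact norm_le_of_forall_integral_le hp hC ζ (hN.isDensity hζ).1 fun Z => (hζ Z).trans (hle Z)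

/-- Every value of `N` is attained on the dual set: the functional `c • Z ↦ c * N Z` on the line
through `Z` extends, by Hahn–Banach, to a linear functional below `N`. Such a functional is positive
and continuous because `N` is monotone and bounded on the unit ball. -/
lemma exists_mem_dualSet_integral_eq [IsProbabilityMeasure P] [Fact (1 ≤ p)] [Fact (1 ≤ q)]
    [ENNReal.HolderConjugate p q] (hN : IsSublinearRisk N) (hp : p ≠ ⊤) (Z : Lp ℝ p P) :
    ∃ ζ ∈ dualSet q N, ∫ ω, Z ω * ζ ω ∂P = N Z := by
  obtain ⟨C, hC, hle⟩ := exists_le_mul_norm_of_monotone hN.mono fun c hc x => hN.smul_eq hc x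
  have h0 : N 0 = 0 := by have := hN.smul_eq two_pos 0; simp at this; linarith
  obtain ⟨g, hgZ, hg⟩ : ∃ g : Lp ℝ p P →ₗ[ℝ] ℝ, g Z = N Z ∧ ∀ Y, g Y ≤ N Y := by
    rcases eq_or_ne Z 0 with rfl | hZ
    · obtain ⟨g, -, hg⟩ := exists_extension_of_le_sublinear (E := Lp ℝ p P) ⊥ N
        (fun c hc x => hN.smul_eq hc x) hN.add_le (fun x => by
          have : (x : Lp ℝ p P) = 0 := (Submodule.mem_bot ℝ).1 x.2
          have hx : x = 0 := Subtype.ext this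
          simp [hx, h0])
      exact ⟨g, by simp [h0], hg⟩
    · obtain ⟨g, hg1, hg2⟩ := exists_extension_of_le_sublinear
        (LinearPMap.mkSpanSingleton Z (N Z) hZ) N (fun c hc x => hN.smul_eq hc x) hN.add_le (by
          rintro ⟨x, hx⟩
          obtain ⟨c, rfl⟩ := Submodule.mem_span_singleton.1 hx
          rw [LinearPMap.mkSpanSingleton'_apply, RingHom.id_apply, smul_eq_mul]
          rcases lt_trichotomy c 0 with hc | rfl | hc
          · -- here `c * N Z = -(|c| * N Z) = -N (-(c • Z)) ≤ N (c • Z)`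
            have e1 := hN.smul_eq (neg_pos.2 hc) Z
            have e2 := hN.add_le (c • Z) ((-c) • Z)
            rw [← add_smul, add_neg_cancel, zero_smul, h0, e1] at e2
            linarith
          · simp [h0]
          · exact (hN.smul_eq hc Z).ge)
      refine ⟨g, ?_, hg2⟩
      have := hg1 ⟨Z, Submodule.mem_span_singleton_self Z⟩
      rw [this]
      exact LinearPMap.mkSpanSingleton_apply ℝ ℝ hZ (N Z)
  have hgC : ∀ Y, ‖g Y‖ ≤ C * ‖Y‖ := by
    intro Y
    rw [Real.norm_eq_abs, abs_le]
    have h1 := (hg Y).trans (hle Y)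
    have h2 := (hg (-Y)).trans (hle (-Y))
    rw [map_neg, norm_neg] at h2
    exact ⟨by linarith, h1⟩
  obtain ⟨ζ, hζ⟩ := exists_forall_eq_integral_of_nonneg (q := q) hp (g.mkContinuous C hgC)
    (fun Y hY => by
      have h1 := hg (-Y)
      have h2 := hN.mono (neg_nonpos.2 hY)
      rw [map_neg] at h1
      rw [LinearMap.mkContinuous_apply]
      linarith)
  refine ⟨ζ, fun Y => ?_, ?_⟩
  · rw [← hζ Y]; exact hg Y
  · rw [← hζ Z]; exact hgZ

lemma isLUB_dualSet [IsProbabilityMeasure P] [Fact (1 ≤ p)] [Fact (1 ≤ q)]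
    [ENNReal.HolderConjugate p q] (hN : IsSublinearRisk N) (hp : p ≠ ⊤) (Z : Lp ℝ p P) :
    IsLUB ((fun ζ : Lp ℝ q P => ∫ ω, Z ω * ζ ω ∂P) '' dualSet q N) (N Z) := by
  refine IsGreatest.isLUB ⟨?_, ?_⟩
  · obtain ⟨ζ, hζ, h⟩ := hN.exists_mem_dualSet_integral_eq (q := q) hp Z
    exact ⟨ζ, hζ, h⟩
  · rintro _ ⟨ζ, hζ, rfl⟩
    exact hζ Z

end IsSublinearRisk

/-- A measure with density in `L_q` integrates `L_p`. -/
lemma integrable_of_memLp_rnDeriv [SigmaFinite P] [ENNReal.HolderConjugate p q]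
    {Q : Measure Ω} [IsFiniteMeasure Q] (hQP : Q ≪ P)
    (hq : MemLp (fun ω => (Q.rnDeriv P ω).toReal) q P) (Z : Lp ℝ p P) :
    Integrable (Z : Ω → ℝ) Q := by
  rw [← integrable_rnDeriv_smul_iff hQP]
  exact hq.integrable_mul (Lp.memLp Z)

lemma mem_measuresOf_dualSet [SigmaFinite P] {Q : Measure Ω} [IsProbabilityMeasure Q]
    (hQP : Q ≪ P)
    (hq : MemLp (fun ω => (Q.rnDeriv P ω).toReal) q P) {N : Lp ℝ p P → ℝ}
    (h : ∀ Z : Lp ℝ p P, ∫ ω, Z ω ∂Q ≤ N Z) : Q ∈ measuresOf P (dualSet q N) := by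
  refine ⟨inferInstance, hQP, hq.toLp _, fun Z => ?_, hq.coeFn_toLp⟩
  refine le_trans (le_of_eq ?_) (h Z)
  rw [← integral_rnDeriv_smul hQP]
  refine integral_congr_ae ?_
  filter_upwards [hq.coeFn_toLp] with ω hω
  rw [hω, smul_eq_mul, mul_comm]

end Dual

end DRO

theorem proposition4p1 {Ω : Type*} {m0 : MeasurableSpace Ω} (P : Measure Ω)
    [IsProbabilityMeasure P] (p q : ℝ≥0∞) [Fact (1 ≤ p)] [Fact (1 ≤ q)] (hp : p ≠ ⊤)
    [ENNReal.HolderConjugate p q]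
    (M : Set (Measure Ω)) (hM_nonempty : M.Nonempty)
    (hM : ∀ Q ∈ M, IsProbabilityMeasure Q ∧ Q ≪ P ∧
      MemLp (fun ω => (Q.rnDeriv P ω).toReal) q P)
    (T : ℕ) (hT : 1 ≤ T) (F : Filtration ℕ m0) (hF_first : F 1 = ⊥) (hF_last : F T = m0)
    (hTE : ∀ G : MeasurableSpace Ω, G ≤ m0 → DRO.CondTranslationEquivariant G p P M)
    (NR : Lp ℝ p P → ℝ)
    (hNR : ∀ Z : Lp ℝ p P,
      DRO.IsCompositeValue P M F T (fun ω => (Z ω : EReal)) (NR Z : EReal)) :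
    ∃ A : Set (Lp ℝ q P),
      Convex ℝ A ∧ Bornology.IsBounded A ∧ IsClosed[DRO.weakStarTopology p q P] A ∧
      (∀ ζ ∈ A, DRO.IsDensity P ζ) ∧
      (∀ Z : Lp ℝ p P, IsLUB ((fun ζ : Lp ℝ q P => ∫ ω, Z ω * ζ ω ∂P) '' A) (NR Z)) ∧
      M ⊆ DRO.measuresOf P A := by
  have hM' : ∀ Q ∈ M, IsProbabilityMeasure Q ∧ Q ≪ P := fun Q hQ => ⟨(hM Q hQ).1, (hM Q hQ).2.1⟩
  have hmeas : ∀ Z : Lp ℝ p P, Measurable (Z : Ω → ℝ) := fun Z =>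
    (Lp.stronglyMeasurable Z).measurable
  have hnull : ∀ A, MeasurableSet A → (∀ Q ∈ M, Q A = 0) → P A = 0 := by
    intro A hA h
    obtain ⟨W, hWT, hW, -⟩ := hNR 0
    have hR := hW T (Finset.mem_Icc.2 ⟨hT, le_rfl⟩)
    rw [hWT, hF_last] at hR
    exact DRO.measure_eq_zero_of_forall (hTE m0 le_rfl) (hmeas 0) (Lp.memLp _) hR hA h
  have hproc : ∀ Z : Lp ℝ p P, ∃ w : ℕ → Ω → ℝ, DRO.IsRobustProcess P M F T w ∧
      w (T + 1) = Z ∧ w 1 = fun _ => NR Z := by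
    intro Z
    refine DRO.exists_isRobustProcess hM' hnull (hmeas Z) (fun Q hQ => ?_) (hNR Z)
    have := (hM Q hQ).1
    exact DRO.integrable_of_memLp_rnDeriv (hM Q hQ).2.1 (hM Q hQ).2.2 Z
  have hN : DRO.IsSublinearRisk NR := by
    intro X Y Z a b c ha hb h
    obtain ⟨u, hu, huT, hu1⟩ := hproc X
    obtain ⟨v, hv, hvT, hv1⟩ := hproc Y
    obtain ⟨w, hw, hwT, hw1⟩ := hproc Z
    have := hu.le_comb hM' hv hw ha hb (by rw [huT, hvT, hwT]; exact h) le_rfl (by omega)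
    obtain ⟨ω, hω⟩ := this.exists
    simpa [hu1, hv1, hw1] using hω
  refine ⟨DRO.dualSet q NR, DRO.convex_dualSet NR, hN.isBounded_dualSet hp,
    DRO.isClosed_dualSet NR, fun ζ hζ => hN.isDensity hζ, hN.isLUB_dualSet hp, fun Q hQ => ?_⟩
  have := (hM Q hQ).1
  refine DRO.mem_measuresOf_dualSet (hM Q hQ).2.1 (hM Q hQ).2.2 fun Z => ?_
  obtain ⟨w, hw, hwT, hw1⟩ := hproc Z
  have := hw.integral_le hQ (t := T + 1) (by omega) le_rfl
  rw [hwT, hw1] at this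
  simpa using this
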